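/- Let $f:\mathbb{R}^n\to\mathbb{R}^n$ and $g:\mathbb{R}^n\to\mathbb{R}^{n\times m}$ be bounded and locally Lipschitz, let $U\subset\mathbb{R}^m$ be a nonempty polytope (the convex hull of finitely many points), and consider the control system $\dot{\mathrm x}=f(\mathrm x)+g(\mathrm x)\mathrm u$ with $\mathrm u(t)\in U$. Let $S=\{x : h(x)\ge 0\}\subseteq\mathbb{R}^n$, where $h:\mathbb{R}^n\to\mathbb{R}$ is continuously differentiable with $\nabla h(x)\neq 0$ for all $x\in\partial S$. Let $a:\mathbb{R}^n\to\mathbb{R}^m$ and $b:\mathbb{R}^n\to\mathbb{R}$ be locally Lipschitz, and put $K(x)=\{u\in U : a(x)^\top u\ge b(x)\}$. Suppose that * for every $x\in S$, $(a(x),b(x))\neq(0,0)$ and $K(x)$ has nonempty interior in $\mathbb{R}^m$; * for every $x\in\partial S$, $K(x)\subseteq\{u\in U : \nabla h(x)\cdot(f(x)+g(x)u)\ge 0\}$. Say that a feedback $\pi:\mathbb{R}^n\to\mathbb{R}^m$ *keeps trajectories from $S$ inside $X$* if for every $x_0\in S$ the closed-loop equation $\dot{\mathrm x}=f(\mathrm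 x)+g(\mathrm x)\pi(\mathrm x)$, $\mathrm x(0)=x_0$, has a solution on $[0,\infty)$, and every solution of it on any interval $[0,T]$ lies in $X$. Then: 1. $a$ and $b$ define a discriminating hyperplane for $S$. That is, $S$ is control invariant (from every $x_0\in S$ some measurable control signal $\mathrm u:[0,\infty)\to U$ has a solution with $\mathrm x(t)\in S$ for all $t\ge0$), and $a(x)^\top u\ge b(x)$ is a valid safety constraint with safe domain $S$: for every target set $X\supseteq S$ there is a locally Lipschitz feedback $\pi:\mathbb{R}^n\to U$ (globally Lipschitz if $S$ is compact) such that $a(x)^\top\pi(x)\ge b(x)$ for all $x\in S$ and $\pi$ keeps trajectories from $S$ inside $X$. 2. Every locally Lipschitz feedback $\pi:\mathbb{R}^n\to U$ with $a(x)^\top\pi(x)\ge b(x)$ for all $x\in S$ keeps trajectories from $S$ inside $S$. 3. For every locally Lipschitz reference controller $\pi_{\rm ref}:\mathbb{R}^n\to U$, the program $\min\{\|u-\pi_{\rm ref}(x)\|^2 : u\in U,\ a(x)^\top u\ge b(x)\}$ has exactly one solution at every $x\in S$; and every feedback $\pi_{\rm safe}$ that solves this program at each $x\in\mathbb{R}^n$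 at which it is feasible (a min-norm safety filter) keeps trajectories from $S$ inside $S$. -/

import Mathlib

open Set

noncomputable section

namespace SafetyFilter

/-- `ℝᵏ` with the Euclidean norm. -/
abbrev Vec (k : ℕ) : Type := EuclideanSpace ℝ (Fin k)

/-- A (nonempty) polytope: the convex hull of a nonempty finite set. -/
def IsPolytope {m : ℕ} (U : Set (Vec m)) : Prop :=
  ∃ V : Finset (Vec m), V.Nonempty ∧ U = convexHull ℝ (V : Set (Vec m))

/-- Standing assumptions on the control-affine system `ẋ = f(x) + g(x) u`, `u ∈ U`:
`f` and `g` are bounded and (locally) Lipschitz and `U` is compact. The matrix `g(x)` is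
given as a linear map `ℝᵐ → ℝⁿ`; boundedness and the Lipschitz property do not depend on
the choice of the matrix norm. -/
structure IsAdmissibleSystem {n m : ℕ} (f : Vec n → Vec n) (g : Vec n → (Vec m →L[ℝ] Vec n))
    (U : Set (Vec m)) : Prop where
  lipschitz_f : LocallyLipschitz f
  lipschitz_g : LocallyLipschitz g
  bounded_f : ∃ C : ℝ, ∀ x, ‖f x‖ ≤ C
  bounded_g : ∃ C : ℝ, ∀ x, ‖g x‖ ≤ C
  compact_U : IsCompact U

/-- `h` is a distance-like function of `S`: it is `C¹`, `S` is its zero-superlevel set, and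
its derivative does not vanish on the boundary of `S`. -/
structure IsDistanceLike {n : ℕ} (h : Vec n → ℝ) (S : Set (Vec n)) : Prop where
  contDiff : ContDiff ℝ 1 h
  eq_superlevel : S = {x | 0 ≤ h x}
  fderiv_ne_zero : ∀ x ∈ frontier S, fderiv ℝ h x ≠ 0

/-- The inputs `u ∈ U` that satisfy the half-space constraint `a(x)ᵀ u ≥ b(x)`. -/
def halfspaceInputs {n m : ℕ} (U : Set (Vec m)) (a : Vec n → Vec m) (b : Vec n → ℝ)
    (x : Vec n) : Set (Vec m) :=
  {u | u ∈ U ∧ b x ≤ inner ℝ (a x) u}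

/-- The inputs `u ∈ U` that satisfy the Nagumo-like condition `∂h/∂x (x) · (f(x) + g(x) u) ≥ 0`. -/
def nagumoInputs {n m : ℕ} (f : Vec n → Vec n) (g : Vec n → (Vec m →L[ℝ] Vec n))
    (U : Set (Vec m)) (h : Vec n → ℝ) (x : Vec n) : Set (Vec m) :=
  {u | u ∈ U ∧ 0 ≤ fderiv ℝ h x (f x + g x u)}

/-- `S` is control invariant: from every initial state in `S` some measurable control signal
with values in `U` has a (Carathéodory) solution that stays in `S` for all `t ≥ 0`. -/
def IsControlInvariant {n m : ℕ} (f : Vec n → Vec n) (g : Vec n → (Vec m →L[ℝ] Vec n))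
    (U : Set (Vec m)) (S : Set (Vec n)) : Prop :=
  ∀ x₀ ∈ S, ∃ (u : ℝ → Vec m) (x : ℝ → Vec n),
    Measurable u ∧ (∀ t, 0 ≤ t → u t ∈ U) ∧ ContinuousOn x (Ici 0) ∧
    (∀ t, 0 ≤ t →
      IntervalIntegrable (fun s => f (x s) + g (x s) (u s)) MeasureTheory.volume 0 t ∧
      x t = x₀ + ∫ s in (0 : ℝ)..t, (f (x s) + g (x s) (u s))) ∧
    ∀ t, 0 ≤ t → x t ∈ S

/-- `x` solves the closed-loop equation `ẋ = f(x) + g(x) π(x)` on the time interval `I`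
(one-sided derivatives at end points of `I`). -/
def IsClosedLoopTrajectory {n m : ℕ} (f : Vec n → Vec n) (g : Vec n → (Vec m →L[ℝ] Vec n))
    (π : Vec n → Vec m) (I : Set ℝ) (x : ℝ → Vec n) : Prop :=
  ∀ t ∈ I, HasDerivWithinAt x (f (x t) + g (x t) (π (x t))) I t

/-- The feedback `π` keeps trajectories from `S` inside `X`: from every initial state in `S`
there is a closed-loop trajectory on `[0, ∞)`, and every closed-loop trajectory, on
whatever interval `[0, T]` it is defined, lies in `X`. -/
def KeepsInside {n m : ℕ} (f : Vec n → Vec n) (g : Vec n → (Vec m →L[ℝ] Vec n))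
    (π : Vec n → Vec m) (S X : Set (Vec n)) : Prop :=
  ∀ x₀ ∈ S,
    (∃ x : ℝ → Vec n, x 0 = x₀ ∧ IsClosedLoopTrajectory f g π (Ici 0) x) ∧
    ∀ (T : ℝ) (x : ℝ → Vec n), x 0 = x₀ → IsClosedLoopTrajectory f g π (Icc 0 T) x →
      ∀ t ∈ Icc 0 T, x t ∈ X

/-- `c(x, u) ≥ 0` is a valid safety constraint with safe domain `S`, for the target
constraint set `X`. The feedback is locally Lipschitz, and globally Lipschitz if the safe
domain is compact. -/
def IsSafetyConstraint {n m : ℕ} (f : Vec n → Vec n) (g : Vec n → (Vec m →L[ℝ] Vec n))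
    (U : Set (Vec m)) (X S : Set (Vec n)) (c : Vec n → Vec m → ℝ) : Prop :=
  S ⊆ X ∧ ∃ π : Vec n → Vec m,
    LocallyLipschitz π ∧ (IsCompact S → ∃ L, LipschitzWith L π) ∧
    (∀ x, π x ∈ U) ∧ (∀ x ∈ S, 0 ≤ c x (π x)) ∧ KeepsInside f g π S X

/-- `a(x)ᵀ u = b(x)` is a discriminating hyperplane for the control invariant set `S`: the
half-space constraint `a(x)ᵀ u - b(x) ≥ 0` is a safety constraint with safe domain `S`, for
every target constraint set `X` that contains `S`. -/
def IsDiscriminatingHyperplane {n m : ℕ} (f : Vec n → Vec n) (g : Vec n → (Vec m →L[ℝ] Vec n))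
    (U : Set (Vec m)) (S : Set (Vec n)) (a : Vec n → Vec m) (b : Vec n → ℝ) : Prop :=
  IsControlInvariant f g U S ∧
    ∀ X : Set (Vec n), S ⊆ X →
      IsSafetyConstraint f g U X S (fun x u => inner ℝ (a x) u - b x)

/-- `u` solves the program: minimize `‖u - r‖²` over `u ∈ U` with `a(x)ᵀ u ≥ b(x)`. -/
def IsMinNormInput {n m : ℕ} (U : Set (Vec m)) (a : Vec n → Vec m) (b : Vec n → ℝ)
    (r : Vec m) (x : Vec n) (u : Vec m) : Prop :=
  u ∈ halfspaceInputs U a b x ∧ IsMinOn (fun v => ‖v - r‖ ^ 2) (halfspaceInputs U a b x) u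

/-- `πsafe` is the min-norm safety filter for the reference controller `πref`: it solves the
program at every state, inside or outside `S`, at which the program is feasible. -/
def IsMinNormFilter {n m : ℕ} (U : Set (Vec m)) (a : Vec n → Vec m) (b : Vec n → ℝ)
    (πref πsafe : Vec n → Vec m) : Prop :=
  ∀ x, (halfspaceInputs U a b x).Nonempty → IsMinNormInput U a b (πref x) x (πsafe x)

end SafetyFilter

end

/-
Every feedback in question has a closed-loop velocity which, at a state `x`, is Lipschitz-close to
a tangent vector of `S` at the boundary point `y` nearest to `x`. This gives `D⁺ d ≤ L d` for the
distance `d` from a trajectory to `S`, so `d` stays zero by Grönwall. For a locally Lipschitz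
feedback `π` the tangent vector comes from the input `π y`. A min-norm filter need not be
Lipschitz, but an input satisfying the constraint strictly makes the feasible set `K x` depend on
`x` in a Lipschitz way, so its value at `x` is still close to *some* point of `K y`; it is
continuous because metric projections onto nearby convex sets are close. Solutions then come from
Peano's theorem, obtained as an ultrafilter limit of the flows of smooth approximations.
-/

namespace SafetyFilter

open Filter Metric
open scoped Topology Manifold

section IntegralCurves

variable {E : Type*} [NormedAddCommGroup E] [NormedSpace ℝ E] {F : E → E} {M : ℝ}

theorem exists_isIntegralCurveOn_Icc_of_locallyLipschitz [ProperSpace E]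
    (hF : LocallyLipschitz F) (hM : ∀ x, ‖F x‖ ≤ M) (x₀ : E) {T : ℝ} (hT : 0 ≤ T) :
    ∃ x : ℝ → E, x 0 = x₀ ∧ IsIntegralCurveOn x (fun _ => F) (Icc (-T) T) := by
  have hM0 : 0 ≤ M := (norm_nonneg _).trans (hM x₀)
  obtain ⟨K, hK⟩ := (hF.locallyLipschitzOn (s := closedBall x₀ (M * T))
    ).exists_lipschitzOnWith_of_compact (isCompact_closedBall _ _)
  have hPL : IsPicardLindelof (fun _ => F) (tmin := -T) (tmax := T)
      ⟨0, neg_nonpos.2 hT, hT⟩ x₀ ⟨M * T, mul_nonneg hM0 hT⟩ 0 ⟨M, hM0⟩ K :=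
    IsPicardLindelof.of_time_independent (fun x _ => hM x) hK (by
      change M * max (T - 0) (0 - -T) ≤ M * T - 0
      simp)
  exact hPL.exists_eq_forall_mem_Icc_hasDerivWithinAt₀

theorem dist_le_mul_dist_of_isIntegralCurveOn {x : ℝ → E} {I : Set ℝ} (hI : Convex ℝ I)
    (hx : IsIntegralCurveOn x (fun _ => F) I) (hM : ∀ z, ‖F z‖ ≤ M) {s t : ℝ} (hs : s ∈ I)
    (ht : t ∈ I) : dist (x s) (x t) ≤ M * dist s t := by
  simpa only [dist_eq_norm] using
    hI.norm_image_sub_le_of_norm_hasDerivWithin_le hx (fun τ _ => hM (x τ)) ht hs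

theorem isIntegralCurve_of_tendsto {ι : Type*} {l : Filter ι} [l.NeBot] {G : ι → E → E}
    {x : ℝ → E} {y : ι → ℝ → E} (hF : Continuous F) (hGF : TendstoUniformly G F l)
    (hM : ∀ i z, ‖G i z‖ ≤ M)
    (hy : ∀ T, ∀ᶠ i in l, IsIntegralCurveOn (y i) (fun _ => G i) (Icc (-T) T))
    (hx : ∀ t, Tendsto (fun i => y i t) l (𝓝 (x t))) :
    IsIntegralCurve x (fun _ => F) := by
  intro t
  have hsub : closedBall t 1 ⊆ Icc (-(|t| + 1)) (|t| + 1) := by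
    rw [Real.closedBall_eq_Icc]
    exact Icc_subset_Icc (by linarith [neg_abs_le t]) (by linarith [le_abs_self t])
  have hyt : ∀ᶠ q : ι × ℝ in l ×ˢ 𝓝 t,
      IsIntegralCurveOn (y q.1) (fun _ => G q.1) (closedBall t 1) ∧ q.2 ∈ ball t 1 :=
    ((hy _).mono fun i hi => hi.mono hsub).prod_mk (ball_mem_nhds t one_pos)
  have hjoint : Tendsto (fun q : ι × ℝ => y q.1 q.2) (l ×ˢ 𝓝 t) (𝓝 (x t)) := by
    have hbound : Tendsto (fun q : ι × ℝ => M * dist q.2 t + dist (y q.1 t) (x t))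
        (l ×ˢ 𝓝 t) (𝓝 0) := by
      simpa using
        (((tendsto_snd (f := l) (g := 𝓝 t)).dist (tendsto_const_nhds (x := t))).const_mul M).add
          (((hx t).comp tendsto_fst).dist (tendsto_const_nhds (x := x t)))
    refine tendsto_iff_dist_tendsto_zero.2
      (squeeze_zero' (.of_forall fun _ => dist_nonneg) (hyt.mono ?_) hbound)
    rintro ⟨i, s⟩ ⟨hi, hs⟩
    exact (dist_triangle _ (y i t) _).trans (add_le_add_left
      (dist_le_mul_dist_of_isIntegralCurveOn (convex_closedBall t 1) hi (hM i)
        (ball_subset_closedBall hs) (mem_closedBall_self zero_le_one)) _)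
  have hderiv : Tendsto (fun q : ι × ℝ => G q.1 (y q.1 q.2)) (l ×ˢ 𝓝 t) (𝓝 (F (x t))) :=
    TendstoUniformly.tendsto_comp (F := fun q : ι × ℝ => G q.1)
      (fun u hu => tendsto_fst.eventually (hGF u hu)) hF.continuousAt hjoint
  refine hasDerivAt_of_tendstoUniformlyOnFilter (f' := fun i s => G i (y i s))
    (g' := fun _ => F (x t)) (tendsto_prod_filter_iff.1 hderiv)
    (hyt.mono fun q hq => ?_) (.of_forall hx)
  exact (hq.1 q.2 (ball_subset_closedBall hq.2)).hasDerivAt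
    (closedBall_mem_nhds_of_mem hq.2)

theorem exists_isIntegralCurve_of_continuous [FiniteDimensional ℝ E] (hF : Continuous F)
    (hM : ∀ x, ‖F x‖ ≤ M) (x₀ : E) :
    ∃ x : ℝ → E, x 0 = x₀ ∧ IsIntegralCurve x (fun _ => F) := by
  have : ProperSpace E := FiniteDimensional.proper ℝ E
  have hε : Tendsto (fun k : ℕ => 1 / ((k : ℝ) + 1)) atTop (𝓝 0) :=
    tendsto_one_div_add_atTop_nhds_zero_nat
  choose G hG hGF _ using fun k : ℕ => hF.exists_contDiff_approx 1
    (ε := fun _ => 1 / ((k : ℝ) + 1)) continuous_const fun _ => by positivity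
  have hGM : ∀ k x, ‖G k x‖ ≤ M + 1 := fun k x => by
    have hk : 1 / ((k : ℝ) + 1) ≤ 1 := div_le_one_of_le₀ (by simp) (by positivity)
    linarith [norm_le_norm_add_norm_sub' (G k x) (F x), hM x, dist_eq_norm (G k x) (F x), hGF k x]
  choose y hy₀ hy using fun k : ℕ =>
    exists_isIntegralCurveOn_Icc_of_locallyLipschitz (hG k).locallyLipschitz (hGM k) x₀
      k.cast_nonneg
  let 𝒰 : Ultrafilter ℕ := hyperfilter ℕ
  have h𝒰 : (𝒰 : Filter ℕ) ≤ atTop := Nat.hyperfilter_le_atTop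
  have hyT : ∀ T, ∀ᶠ k : ℕ in 𝒰, IsIntegralCurveOn (y k) (fun _ => G k) (Icc (-T) T) := fun T =>
    ((tendsto_natCast_atTop_atTop.eventually_ge_atTop T).filter_mono h𝒰).mono fun k hk =>
      (hy k).mono (Icc_subset_Icc (neg_le_neg hk) hk)
  have hlim : ∀ t : ℝ, ∃ p, Tendsto (fun k => y k t) 𝒰 (𝓝 p) := fun t => by
    have hmem : ∀ᶠ k in 𝒰, y k t ∈ closedBall x₀ ((M + 1) * dist t 0) :=
      (hyT |t|).mono fun k hk => by
        simpa only [hy₀, mem_closedBall] using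
          dist_le_mul_dist_of_isIntegralCurveOn (convex_Icc _ _) hk (hGM k) (abs_le.1 le_rfl)
            (abs_le.1 (abs_zero.trans_le (abs_nonneg t)))
    obtain ⟨p, -, hp⟩ := (isCompact_closedBall x₀ ((M + 1) * dist t 0)).ultrafilter_le_nhds
      (𝒰.map fun k => y k t) (le_principal_iff.2 hmem)
    exact ⟨p, hp⟩
  choose x hx using hlim
  refine ⟨x, tendsto_nhds_unique (hx 0) (by simp [hy₀]),
    isIntegralCurve_of_tendsto hF ?_ hGM hyT hx⟩
  refine Metric.tendstoUniformly_iff.2 fun ε hε' => ?_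
  filter_upwards [(hε.eventually (gt_mem_nhds hε')).filter_mono h𝒰] with k hk z
  exact (dist_comm _ _).trans_lt ((hGF k z).trans hk)

end IntegralCurves

section LocallyLipschitzTowards

variable {X Y : Type*} [PseudoMetricSpace X] [PseudoMetricSpace Y] {φ ψ : X → Y}
  {K : X → Set Y} {A : Set X}

/-- `φ` is locally Lipschitz towards the set-valued map `K` along `A`: locally, `φ x` is within
distance `L * dist x y` of *some* point of `K y` whenever `y ∈ A`. This one-sided comparison holds
for locally Lipschitz selections of `K` and also for selections that are merely continuous, provided
`K` itself is locally Lipschitz for the Hausdorff distance. -/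
def LocallyLipschitzTowards (φ : X → Y) (K : X → Set Y) (A : Set X) : Prop :=
  ∀ p ∈ A, ∃ V ∈ 𝓝 p, ∃ L : ℝ, ∀ x ∈ V, ∀ y ∈ V ∩ A, ∃ w ∈ K y, dist (φ x) w ≤ L * dist x y

theorem locallyLipschitzTowards_of_locallyLipschitz (hφ : LocallyLipschitz φ)
    (hK : ∀ y ∈ A, φ y ∈ K y) : LocallyLipschitzTowards φ K A := by
  intro p _
  obtain ⟨L, V, hV, hL⟩ := hφ p
  exact ⟨V, hV, L, fun x hx y hy => ⟨φ y, hK y hy.2, hL.dist_le_mul x hx y hy.1⟩⟩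

theorem LocallyLipschitzTowards.congr {V : Set X} (hφ : LocallyLipschitzTowards φ K A)
    (hV : IsOpen V) (hAV : A ⊆ V) (hψ : EqOn ψ φ V) : LocallyLipschitzTowards ψ K A := by
  intro p hp
  obtain ⟨W, hW, L, hL⟩ := hφ p hp
  refine ⟨W ∩ V, inter_mem hW (hV.mem_nhds (hAV hp)), L, fun x hx y hy => ?_⟩
  rw [hψ hx.2]
  exact hL x hx.1 y ⟨hy.1.1, hy.2⟩

theorem LocallyLipschitzTowards.mono {K' : X → Set Y} {B : Set X}
    (hφ : LocallyLipschitzTowards φ K A) (hBA : B ⊆ A) (hK : ∀ y ∈ B, K y ⊆ K' y) :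
    LocallyLipschitzTowards φ K' B := by
  intro p hp
  obtain ⟨V, hV, L, hL⟩ := hφ p (hBA hp)
  refine ⟨V, hV, L, fun x hx y hy => ?_⟩
  obtain ⟨w, hw, hxw⟩ := hL x hx y ⟨hy.1, hBA hy.2⟩
  exact ⟨w, hK y hy.2 hw, hxw⟩

theorem LocallyLipschitzTowards.add_clm_apply {E E' : Type*} [NormedAddCommGroup E]
    [NormedSpace ℝ E] [NormedAddCommGroup E'] [NormedSpace ℝ E'] {f : X → E'}
    {g : X → E →L[ℝ] E'} {π : X → E} {K : X → Set E} {R : ℝ} (hf : LocallyLipschitz f)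
    (hg : LocallyLipschitz g) (hπ : LocallyLipschitzTowards π K A)
    (hK : ∀ y ∈ A, ∀ u ∈ K y, ‖u‖ ≤ R) :
    LocallyLipschitzTowards (fun x => f x + g x (π x)) (fun y => (fun u => f y + g y u) '' K y)
      A := by
  intro p hp
  obtain ⟨Lf, Vf, hVf, hLf⟩ := hf p
  obtain ⟨Lg, Vg, hVg, hLg⟩ := hg p
  obtain ⟨W, hW, Lπ, hLπ⟩ := hπ p hp
  obtain ⟨C, hC⟩ := exists_gt ‖g p‖
  have hgC : ∀ᶠ x in 𝓝 p, ‖g x‖ < C := hg.continuous.norm.continuousAt.eventually (gt_mem_nhds hC)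
  refine ⟨(Vf ∩ Vg) ∩ (W ∩ {x | ‖g x‖ < C}), inter_mem (inter_mem hVf hVg) (inter_mem hW hgC),
    Lf + C * Lπ + Lg * R, ?_⟩
  rintro x ⟨⟨hxf, hxg⟩, hxπ, hxC⟩ y ⟨⟨⟨hyf, hyg⟩, hyπ, -⟩, hyA⟩
  obtain ⟨u, hu, hxu⟩ := hLπ x hxπ y ⟨hyπ, hyA⟩
  refine ⟨f y + g y u, mem_image_of_mem _ hu, ?_⟩
  have hdrift : ‖f x - f y‖ ≤ Lf * dist x y := by
    simpa only [dist_eq_norm] using hLf.dist_le_mul x hxf y hyf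
  have hinput : ‖g x (π x - u)‖ ≤ C * (Lπ * dist x y) :=
    (g x).le_of_opNorm_le_of_le (le_of_lt hxC) (by rwa [← dist_eq_norm])
  have hgain : ‖(g x - g y) u‖ ≤ Lg * dist x y * R :=
    (g x - g y).le_of_opNorm_le_of_le
      (by simpa only [dist_eq_norm] using hLg.dist_le_mul x hxg y hyg) (hK y hyA u hu)
  calc dist (f x + g x (π x)) (f y + g y u)
      = ‖(f x - f y) + g x (π x - u) + (g x - g y) u‖ := by
        rw [dist_eq_norm, map_sub, _root_.sub_apply]; congr 1; abel
    _ ≤ ‖f x - f y‖ + ‖g x (π x - u)‖ + ‖(g x - g y) u‖ := norm_add₃_le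
    _ ≤ (Lf + C * Lπ + Lg * R) * dist x y := by linarith

end LocallyLipschitzTowards

section TangentCone

variable {E : Type*} [NormedAddCommGroup E] [NormedSpace ℝ E] {S : Set E} {y v w : E}

theorem isClosed_posTangentConeAt (S : Set E) (y : E) : IsClosed (posTangentConeAt S y) := by
  rw [posTangentConeAt, tangentConeAt_def]
  exact isClosed_setOfPred_clusterPt

theorem eventually_nonneg_add_smul_of_fderiv_pos {h : E → ℝ} (hd : DifferentiableAt ℝ h y)
    (hy : 0 ≤ h y) (hv : 0 < fderiv ℝ h y v) : ∀ᶠ s in 𝓝[>] (0 : ℝ), 0 ≤ h (y + s • v) := by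
  have hslope := (hd.hasFDerivAt.hasLineDerivAt v).hasDerivWithinAt (s := Ioi 0)
  rw [hasDerivWithinAt_iff_tendsto_slope' (by simp)] at hslope
  filter_upwards [hslope.eventually (lt_mem_nhds hv), self_mem_nhdsWithin] with s hs hs0
  rw [slope_def_field, sub_zero, div_pos_iff_of_pos_right hs0] at hs
  simp only [zero_smul, add_zero] at hs
  linarith

theorem mem_posTangentConeAt_of_fderiv_nonneg {h : E → ℝ} (hd : DifferentiableAt ℝ h y)
    (hy : 0 ≤ h y) (hne : fderiv ℝ h y ≠ 0) (hw : 0 ≤ fderiv ℝ h y w) :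
    w ∈ posTangentConeAt {x | 0 ≤ h x} y := by
  obtain ⟨v, hv⟩ : ∃ v, 0 < fderiv ℝ h y v := by
    obtain ⟨v, hv⟩ := DFunLike.ne_iff.1 hne
    rcases lt_or_gt_of_ne hv with hv | hv
    · exact ⟨-v, by simpa using hv⟩
    · exact ⟨v, hv⟩
  have hlim : Tendsto (fun ε : ℝ => w + ε • v) (𝓝[>] 0) (𝓝 w) :=
    ((by fun_prop : Continuous fun ε : ℝ => w + ε • v).tendsto' 0 w (by simp)).mono_left
      nhdsWithin_le_nhds
  refine (isClosed_posTangentConeAt _ y).mem_of_tendsto hlim ?_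
  filter_upwards [self_mem_nhdsWithin] with ε hε
  have hpos : 0 < fderiv ℝ h y (w + ε • v) := by
    rw [map_add, map_smul, smul_eq_mul]
    exact add_pos_of_nonneg_of_pos hw (mul_pos hε hv)
  exact mem_posTangentConeAt_of_frequently_mem
    (eventually_nonneg_add_smul_of_fderiv_pos hd hy hpos).frequently

theorem frequently_infDist_add_smul_lt (hy : y ∈ S) (hw : w ∈ posTangentConeAt S y) {ε : ℝ}
    (hε : 0 < ε) : ∃ᶠ s in 𝓝[>] (0 : ℝ), infDist (y + s • w) S < ε * s := by
  rcases eq_or_ne w 0 with rfl | hw0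
  · refine Eventually.frequently ?_
    filter_upwards [self_mem_nhdsWithin] with s hs
    rw [smul_zero, add_zero, infDist_zero_of_mem hy]
    exact mul_pos hε hs
  obtain ⟨ι, l, hl, c, d, hd, hdS, hcd⟩ := exists_fun_of_mem_tangentConeAt hw
  have hcpos : ∀ᶠ i in l, 0 < (c i : ℝ) := by
    filter_upwards [hcd.eventually_ne hw0] with i hi
    exact NNReal.coe_pos.2 (pos_iff_ne_zero.2 (left_ne_zero_of_smul hi))
  have hc : Tendsto (fun i => (c i : ℝ)⁻¹) l (𝓝[>] 0) := by
    refine tendsto_nhdsWithin_iff.2 ⟨?_, hcpos.mono fun i => inv_pos.2⟩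
    have hquot : Tendsto (fun i => ‖d i‖ / ‖c i • d i‖) l (𝓝 0) := by
      simpa using! hd.norm.div hcd.norm (norm_ne_zero_iff.2 hw0)
    refine hquot.congr' ?_
    filter_upwards [hcd.eventually_ne hw0] with i hi
    have hdi : ‖d i‖ ≠ 0 := norm_ne_zero_iff.2 (right_ne_zero_of_smul hi)
    rw [NNReal.smul_def, norm_smul, NNReal.norm_eq]
    field_simp
  refine hc.frequently (Eventually.frequently ?_)
  filter_upwards [hcpos, hdS, hcd.eventually (ball_mem_nhds w hε)] with i hci hdi hwi
  calc infDist (y + (c i : ℝ)⁻¹ • w) S ≤ dist (y + (c i : ℝ)⁻¹ • w) (y + d i) :=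
        infDist_le_dist_of_mem hdi
    _ = dist (c i • d i) w * (c i : ℝ)⁻¹ := by
        rw [dist_add_left, ← inv_smul_smul₀ hci.ne' (d i), dist_smul₀, NNReal.smul_def, dist_comm,
          Real.norm_of_nonneg (inv_nonneg.2 hci.le), mul_comm, smul_inv_smul₀ hci.ne']
    _ < ε * (c i : ℝ)⁻¹ := mul_lt_mul_of_pos_right hwi (inv_pos.2 hci)

theorem frequently_slope_infDist_lt {x : ℝ → E} {t r : ℝ}
    (hx : HasDerivWithinAt x v (Ioi t) t) (hy : y ∈ S) (hxy : infDist (x t) S = dist (x t) y)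
    (hw : w ∈ posTangentConeAt S y) (hr : dist v w < r) :
    ∃ᶠ z in 𝓝[>] t, (z - t)⁻¹ * (infDist (x z) S - infDist (x t) S) < r := by
  obtain ⟨ε, hε, hεr⟩ : ∃ ε > 0, 2 * ε + dist v w = r :=
    ⟨(r - dist v w) / 2, half_pos (sub_pos.2 hr), by ring⟩
  have hshift : Tendsto (fun s => t + s) (𝓝[>] 0) (𝓝[>] t) := by
    simpa using tendsto_map (f := fun s => t + s) (x := 𝓝[>] (0 : ℝ))
  have htan : ∃ᶠ z in 𝓝[>] t, infDist (y + (z - t) • w) S < ε * (z - t) :=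
    hshift.frequently (by simpa using frequently_infDist_add_smul_lt hy hw hε)
  have happrox := (hasDerivWithinAt_iff_isLittleO.1 hx).def hε
  refine (htan.and_eventually (happrox.and self_mem_nhdsWithin)).mono fun z ⟨hz, hxz, hzt⟩ => ?_
  have hzt : 0 < z - t := sub_pos.2 hzt
  rw [Real.norm_of_nonneg hzt.le] at hxz
  have hdist : dist (x z) (y + (z - t) • w) ≤
      ε * (z - t) + infDist (x t) S + (z - t) * dist v w :=
    calc dist (x z) (y + (z - t) • w)
        = ‖(x z - x t - (z - t) • v) + (x t - y) + (z - t) • (v - w)‖ := by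
          rw [dist_eq_norm, smul_sub]; congr 1; abel
      _ ≤ ‖x z - x t - (z - t) • v‖ + ‖x t - y‖ + ‖(z - t) • (v - w)‖ := norm_add₃_le
      _ ≤ ε * (z - t) + infDist (x t) S + (z - t) * dist v w := by
          rw [norm_smul, Real.norm_of_nonneg hzt.le, hxy, ← dist_eq_norm v, ← dist_eq_norm (x t)]
          gcongr
  rw [inv_mul_lt_iff₀ hzt, ← hεr]
  linarith [hz, infDist_le_infDist_add_dist (s := S) (x := x z) (y := y + (z - t) • w)]

end TangentCone

theorem exists_continuous_norm_le_eqOn {X : Type*} [TopologicalSpace X] [NormalSpace X]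
    {E : Type*} [NormedAddCommGroup E] [NormedSpace ℝ E] {F : X → E} {S N : Set X} {M : ℝ}
    (hS : IsClosed S) (hN : IsOpen N) (hSN : S ⊆ N) (hF : ContinuousOn F N)
    (hM : ∀ x ∈ N, ‖F x‖ ≤ M) :
    ∃ G : X → E, Continuous G ∧ (∀ x, ‖G x‖ ≤ |M|) ∧ ∃ V, IsOpen V ∧ S ⊆ V ∧ EqOn G F V := by
  obtain ⟨V, hV, hSV, hVN⟩ := normal_exists_closure_subset hS hN hSN
  obtain ⟨W, hW, hVW, hWN⟩ := normal_exists_closure_subset isClosed_closure hN hVN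
  obtain ⟨χ, hχ0, hχ1, hχ⟩ := exists_continuous_zero_one_of_isClosed hW.isClosed_compl
    isClosed_closure (disjoint_compl_left_iff_subset.2 hVW)
  have hχN : ∀ x ∉ N, χ x = 0 := fun x hx => hχ0 fun hxW => hx (hWN (subset_closure hxW))
  refine ⟨fun x => χ x • F x, continuous_iff_continuousAt.2 fun x => ?_, fun x => ?_,
    V, hV, hSV, fun x hx => ?_⟩
  · by_cases hx : x ∈ N
    · exact χ.continuous.continuousAt.smul (hF.continuousAt (hN.mem_nhds hx))
    · have hzero : (fun x => χ x • F x) =ᶠ[𝓝 x] fun _ => 0 := by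
        filter_upwards [isClosed_closure.isOpen_compl.mem_nhds fun hxW => hx (hWN hxW)] with z hz
        rw [hχ0 fun hzW => hz (subset_closure hzW), Pi.zero_apply, zero_smul]
      exact continuousAt_const.congr hzero.symm
  · rw [norm_smul, Real.norm_of_nonneg (hχ x).1]
    by_cases hx : x ∈ N
    · exact (mul_le_of_le_one_left (norm_nonneg _) (hχ x).2).trans
        ((hM x hx).trans (le_abs_self M))
    · rw [hχN x hx, zero_mul]
      exact abs_nonneg M
  · simp only [hχ1 (subset_closure hx), Pi.one_apply, one_smul]

section Nagumo

variable {E : Type*} [NormedAddCommGroup E] [NormedSpace ℝ E] [FiniteDimensional ℝ E]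
  {S : Set E} {F : E → E} {x : ℝ → E} {t T : ℝ}

theorem exists_mem_frontier_infDist_eq_dist (hne : S.Nonempty) {p : E}
    (hp : p ∉ interior S) : ∃ y ∈ frontier S, infDist p S = dist p y := by
  by_cases hpS : p ∈ S
  · exact ⟨p, ⟨subset_closure hpS, hp⟩, by rw [infDist_zero_of_mem hpS, dist_self]⟩
  · simpa only [frontier_compl, compl_compl] using
      exists_mem_frontier_infDist_compl_eq_dist (s := Sᶜ) hpS (compl_ne_univ.2 hne)

theorem frequently_slope_infDist_lt_of_ball (hS : IsClosed S) {p : E} (hp : p ∈ S) {ρ L : ℝ}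
    (hF : ∀ z ∈ ball p ρ, ∀ y ∈ ball p ρ ∩ frontier S,
      ∃ w ∈ posTangentConeAt S y, dist (F z) w ≤ L * dist z y)
    (hx : HasDerivWithinAt x (F (x t)) (Ioi t) t) (hxt : x t ∈ ball p (ρ / 2)) {r : ℝ}
    (hr : L * infDist (x t) S < r) :
    ∃ᶠ z in 𝓝[>] t, (z - t)⁻¹ * (infDist (x z) S - infDist (x t) S) < r := by
  by_cases hint : x t ∈ interior S
  · have hzero : infDist (x t) S = 0 := infDist_zero_of_mem (interior_subset hint)
    refine Eventually.frequently ?_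
    filter_upwards [hx.continuousWithinAt.eventually (mem_interior_iff_mem_nhds.1 hint)] with z hz
    rwa [infDist_zero_of_mem hz, hzero, sub_zero, mul_zero, ← mul_zero L, ← hzero]
  · obtain ⟨y, hyS, hy⟩ := exists_mem_frontier_infDist_eq_dist ⟨p, hp⟩ hint
    have hyp : y ∈ ball p ρ := by
      have hle : dist (x t) y ≤ dist (x t) p := hy ▸ infDist_le_dist_of_mem hp
      rw [mem_ball] at hxt ⊢
      linarith [dist_triangle_left y p (x t)]
    have hxp : x t ∈ ball p ρ :=
      ball_subset_ball (half_le_self (nonempty_ball.1 ⟨y, hyp⟩).le) hxt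
    obtain ⟨w, hw, hFw⟩ := hF _ hxp y ⟨hyp, hyS⟩
    exact frequently_slope_infDist_lt hx (hS.frontier_subset hyS) hy hw
      (hFw.trans_lt (hy ▸ hr))

theorem eventually_nhdsGT_mem_of_isIntegralCurveOn (hS : IsClosed S)
    (hF : LocallyLipschitzTowards F (posTangentConeAt S) (frontier S))
    (hx : IsIntegralCurveOn x (fun _ => F) (Icc 0 T)) (ht : t ∈ Ico 0 T) (hxt : x t ∈ S) :
    ∀ᶠ s in 𝓝[>] t, x s ∈ S := by
  have hcont : ContinuousWithinAt x (Ici t) t :=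
    (hx t (Ico_subset_Icc_self ht)).continuousWithinAt.mono_of_mem_nhdsWithin
      (Icc_mem_nhdsGE_of_mem ht)
  by_cases hint : x t ∈ interior S
  · exact (hcont.mono Ioi_subset_Ici_self).eventually (mem_interior_iff_mem_nhds.1 hint)
  obtain ⟨V, hV, L, hL⟩ := hF (x t) ⟨subset_closure hxt, hint⟩
  obtain ⟨ρ, hρ, hρV⟩ := Metric.mem_nhds_iff.1 hV
  obtain ⟨u, htu, hu⟩ := mem_nhdsGE_iff_exists_Icc_subset.1
    (inter_mem (hcont (ball_mem_nhds (x t) (half_pos hρ))) (Icc_mem_nhdsGE_of_mem ht))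
  have hdist : ContinuousOn (fun s => infDist (x s) S) (Icc t u) :=
    (continuous_infDist_pt S).comp_continuousOn
      ((IsIntegralCurveOn.continuousOn hx).mono fun s hs => (hu hs).2)
  have hslope : ∀ s ∈ Ico t u, ∀ r, L * infDist (x s) S < r →
      ∃ᶠ z in 𝓝[>] s, (z - s)⁻¹ * (infDist (x z) S - infDist (x s) S) < r := fun s hs r =>
    have hsT : s ∈ Ico 0 T := ⟨(hu (Ico_subset_Icc_self hs)).2.1,
      hs.2.trans_le (hu (right_mem_Icc.2 htu.le)).2.2⟩
    frequently_slope_infDist_lt_of_ball hS hxt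
      (fun z hz y hy => hL z (hρV hz) y ⟨hρV hy.1, hy.2⟩)
      ((hx s (Ico_subset_Icc_self hsT)).mono_of_mem_nhdsWithin (Icc_mem_nhdsGT_of_mem hsT))
      (hu (Ico_subset_Icc_self hs)).1
  filter_upwards [Icc_mem_nhdsGT htu] with s hs
  have hgronwall := le_gronwallBound_of_liminf_deriv_right_le hdist hslope
    (infDist_zero_of_mem hxt).le (K := L) (ε := 0) (fun s _ => (add_zero _).ge) s hs
  rw [gronwallBound_ε0_δ0] at hgronwall
  exact (hS.mem_iff_infDist_zero ⟨_, hxt⟩).2 (hgronwall.antisymm infDist_nonneg)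

theorem mem_of_isIntegralCurveOn_Icc (hS : IsClosed S)
    (hF : LocallyLipschitzTowards F (posTangentConeAt S) (frontier S))
    (hx : IsIntegralCurveOn x (fun _ => F) (Icc 0 T)) (hx₀ : x 0 ∈ S) (ht : t ∈ Icc 0 T) :
    x t ∈ S := by
  have hclosed : IsClosed (x ⁻¹' S ∩ Icc 0 T) := by
    rw [inter_comm]
    exact (IsIntegralCurveOn.continuousOn hx).preimage_isClosed_of_isClosed isClosed_Icc hS
  exact hclosed.Icc_subset_of_forall_mem_nhdsWithin hx₀
    (fun s hs => eventually_nhdsGT_mem_of_isIntegralCurveOn hS hF hx hs.2 hs.1) ht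

theorem exists_isIntegralCurveOn_Ici_of_continuousOn (hS : IsClosed S)
    (hF : LocallyLipschitzTowards F (posTangentConeAt S) (frontier S)) {N : Set E} {M : ℝ}
    (hN : IsOpen N) (hSN : S ⊆ N) (hFN : ContinuousOn F N) (hM : ∀ z ∈ N, ‖F z‖ ≤ M)
    {x₀ : E} (hx₀ : x₀ ∈ S) :
    ∃ x : ℝ → E, x 0 = x₀ ∧ IsIntegralCurveOn x (fun _ => F) (Ici 0) := by
  obtain ⟨G, hG, hGM, V, hV, hSV, hGF⟩ := exists_continuous_norm_le_eqOn hS hN hSN hFN hM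
  obtain ⟨x, hx, hxG⟩ := exists_isIntegralCurve_of_continuous hG hGM x₀
  have hGtan := hF.congr hV (hS.frontier_subset.trans hSV) hGF
  refine ⟨x, hx, fun t ht => ?_⟩
  have hxt : x t ∈ S := mem_of_isIntegralCurveOn_Icc hS hGtan (hxG.isIntegralCurveOn _)
    (hx.symm ▸ hx₀) (right_mem_Icc.2 ht)
  simpa only [hGF (hSV hxt)] using (hxG t).hasDerivWithinAt (s := Ici 0)

end Nagumo

theorem isMinOn_norm_sub_sq_iff {E : Type*} [SeminormedAddCommGroup E] {K : Set E} {r u : E}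
    (hu : u ∈ K) :
    IsMinOn (fun v => ‖v - r‖ ^ 2) K u ↔ ‖r - u‖ = ⨅ v : K, ‖r - v‖ := by
  have : Nonempty K := ⟨u, hu⟩
  have hbdd : BddBelow (range fun v : K => ‖r - v‖) := ⟨0, by rintro _ ⟨v, rfl⟩; positivity⟩
  rw [isMinOn_iff]
  simp only [sq_le_sq₀ (norm_nonneg _) (norm_nonneg _), norm_sub_rev _ r]
  exact ⟨fun h => (le_ciInf fun v : K => h v v.2).antisymm (ciInf_le hbdd ⟨u, hu⟩),
    fun h v hv => h.trans_le (ciInf_le hbdd ⟨v, hv⟩)⟩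

section MetricProjection

variable {E : Type*} [NormedAddCommGroup E] [InnerProductSpace ℝ E] {K K' : Set E}
  {r r' u u' w w' : E}

theorem norm_sub_sq_le_of_isMinOn (hK : Convex ℝ K) (hK' : Convex ℝ K') (hu : u ∈ K)
    (hmin : IsMinOn (fun v => ‖v - r‖ ^ 2) K u) (hu' : u' ∈ K')
    (hmin' : IsMinOn (fun v => ‖v - r'‖ ^ 2) K' u') (hw : w ∈ K) (hw' : w' ∈ K') :
    ‖u' - u‖ ^ 2 ≤ ‖r - u‖ * ‖u' - w‖ + ‖r' - u'‖ * ‖u - w'‖ + ‖r' - r‖ * ‖u' - u‖ := by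
  have hobtuse : inner ℝ (r - u) (w - u) ≤ 0 :=
    (norm_eq_iInf_iff_real_inner_le_zero hK hu).1 ((isMinOn_norm_sub_sq_iff hu).1 hmin) w hw
  have hobtuse' : inner ℝ (r' - u') (w' - u') ≤ 0 :=
    (norm_eq_iInf_iff_real_inner_le_zero hK' hu').1 ((isMinOn_norm_sub_sq_iff hu').1 hmin') w' hw'
  have hsplit : ‖u' - u‖ ^ 2 = inner ℝ (r - u) (w - u) + inner ℝ (r - u) (u' - w) +
      (inner ℝ (r' - u') (w' - u') + inner ℝ (r' - u') (u - w')) +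
      inner ℝ (r' - r) (u' - u) := by
    rw [← real_inner_self_eq_norm_sq, ← inner_add_right, ← inner_add_right, sub_add_sub_cancel',
      sub_add_sub_cancel', ← neg_sub u' u, inner_neg_right, ← sub_eq_add_neg, ← inner_sub_left,
      ← inner_add_left]
    congr 1
    abel
  linarith [real_inner_le_norm (r - u) (u' - w), real_inner_le_norm (r' - u') (u - w'),
    real_inner_le_norm (r' - r) (u' - u)]

theorem existsUnique_isMinOn_norm_sub_sq (hK : Convex ℝ K) (hKc : IsComplete K)
    (hne : K.Nonempty) (r : E) : ∃! u, u ∈ K ∧ IsMinOn (fun v => ‖v - r‖ ^ 2) K u := by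
  obtain ⟨u, hu, hr⟩ := exists_norm_eq_iInf_of_complete_convex hne hKc hK r
  have hmin := (isMinOn_norm_sub_sq_iff hu).2 hr
  refine ⟨u, ⟨hu, hmin⟩, fun u' ⟨hu', hmin'⟩ => ?_⟩
  have hsq : ‖u' - u‖ ^ 2 ≤ 0 := by
    simpa only [sub_self, norm_zero, mul_zero, zero_mul, add_zero] using
      norm_sub_sq_le_of_isMinOn hK hK hu hmin hu' hmin' hu' hu
  exact sub_eq_zero.1 (norm_eq_zero.1 (pow_eq_zero_iff two_ne_zero |>.1
    (hsq.antisymm (sq_nonneg _))))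

end MetricProjection

theorem exists_mem_le_map_dist_le {E : Type*} [NormedAddCommGroup E] [NormedSpace ℝ E] {U : Set E}
    {u v : E} (hU : Convex ℝ U) (hu : u ∈ U) (hv : v ∈ U) (ℓ : E →ₗ[ℝ] ℝ) {β η δ : ℝ}
    (hη : 0 ≤ η) (hδ : 0 < δ) (hℓu : β - η ≤ ℓ u) (hℓv : β + δ ≤ ℓ v) :
    ∃ w ∈ U, β ≤ ℓ w ∧ dist u w ≤ η / δ * dist u v := by
  set θ := η / (η + δ) with hθ
  have hθ0 : 0 ≤ θ := by positivity
  have hθ1 : θ ≤ 1 := div_le_one_of_le₀ (by linarith) (by positivity)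
  have hbalance : (1 - θ) * η = θ * δ := by rw [hθ]; field_simp; ring
  refine ⟨AffineMap.lineMap u v θ, hU.lineMap_mem hu hv ⟨hθ0, hθ1⟩, ?_, ?_⟩
  · rw [AffineMap.lineMap_apply_module, map_add, map_smul, map_smul, smul_eq_mul, smul_eq_mul]
    linarith [mul_le_mul_of_nonneg_left hℓu (sub_nonneg.2 hθ1),
      mul_le_mul_of_nonneg_left hℓv hθ0]
  · rw [dist_left_lineMap, Real.norm_of_nonneg hθ0]
    have hθδ : θ ≤ η / δ := div_le_div_of_nonneg_left hη hδ (by linarith)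
    exact mul_le_mul_of_nonneg_right hθδ dist_nonneg

theorem exists_lipschitzWith_forall_mem_eqOn {E F : Type*} [NormedAddCommGroup E] [NormedSpace ℝ E]
    [FiniteDimensional ℝ E] [NormedAddCommGroup F] [NormedSpace ℝ F] {φ : E → F} {U : Set F}
    {B : Set E} (hU : Convex ℝ U) (hφ : ContDiff ℝ 1 φ) (hφU : ∀ x, φ x ∈ U)
    (hB : Bornology.IsBounded B) :
    ∃ ψ : E → F, (∃ L, LipschitzWith L ψ) ∧ (∀ x, ψ x ∈ U) ∧ EqOn ψ φ B := by
  obtain ⟨R, hR0, hR⟩ := hB.exists_pos_norm_le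
  let χ : ContDiffBump (0 : E) := ⟨R, R + 1, hR0, lt_add_one R⟩
  have hcs : HasCompactSupport fun x => χ x • (φ x - φ 0) := χ.hasCompactSupport.smul_right
  obtain ⟨L, hL⟩ := ContDiff.lipschitzWith_of_hasCompactSupport (𝕂 := ℝ) hcs
    (χ.contDiff.smul (hφ.sub contDiff_const)) one_ne_zero
  refine ⟨fun x => φ 0 + χ x • (φ x - φ 0), ⟨0 + L, (LipschitzWith.const (φ 0)).add hL⟩,
    fun x => hU.add_smul_sub_mem (hφU 0) (hφU x) ⟨χ.nonneg, χ.le_one⟩, fun x hx => ?_⟩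
  have hχ : χ x = 1 := χ.one_of_mem_closedBall (mem_closedBall_zero_iff.2 (hR x hx))
  simp only [hχ, one_smul, add_sub_cancel]

section ControlSystem

variable {n m : ℕ} {f : Vec n → Vec n} {g : Vec n → (Vec m →L[ℝ] Vec n)} {U : Set (Vec m)}
  {S : Set (Vec n)} {a : Vec n → Vec m} {b : Vec n → ℝ} {π πref πsafe : Vec n → Vec m}

theorem IsPolytope.convex (hU : IsPolytope U) : Convex ℝ U := by
  obtain ⟨V, -, rfl⟩ := hU
  exact convex_convexHull ℝ _

theorem IsPolytope.nonempty (hU : IsPolytope U) : U.Nonempty := by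
  obtain ⟨V, hV, rfl⟩ := hU
  exact hV.to_set.convexHull

theorem IsDistanceLike.isClosed {h : Vec n → ℝ} (hh : IsDistanceLike h S) : IsClosed S :=
  hh.eq_superlevel ▸ isClosed_le continuous_const hh.contDiff.continuous

theorem IsDistanceLike.mem_posTangentConeAt {h : Vec n → ℝ} (hh : IsDistanceLike h S)
    {x v : Vec n} (hx : x ∈ frontier S) (hv : 0 ≤ fderiv ℝ h x v) : v ∈ posTangentConeAt S x := by
  have hxS : x ∈ {z | 0 ≤ h z} := hh.eq_superlevel ▸ hh.isClosed.frontier_subset hx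
  rw [hh.eq_superlevel]
  exact mem_posTangentConeAt_of_fderiv_nonneg (hh.contDiff.differentiable one_ne_zero x) hxS
    (hh.fderiv_ne_zero x hx) hv

theorem KeepsInside.mono {X Y : Set (Vec n)} (hπ : KeepsInside f g π S X) (hXY : X ⊆ Y) :
    KeepsInside f g π S Y := fun x₀ hx₀ =>
  ⟨(hπ x₀ hx₀).1, fun T x hx hxT t ht => hXY ((hπ x₀ hx₀).2 T x hx hxT t ht)⟩

theorem keepsInside_of_locallyLipschitzTowards (hsys : IsAdmissibleSystem f g U)
    (hS : IsClosed S) {K : Vec n → Set (Vec m)} (hKU : ∀ y, K y ⊆ U)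
    (hK : ∀ y ∈ frontier S, ∀ u ∈ K y, f y + g y u ∈ posTangentConeAt S y) {N : Set (Vec n)}
    (hN : IsOpen N) (hSN : S ⊆ N) (hπN : ContinuousOn π N) (hπU : MapsTo π N U)
    (hπ : LocallyLipschitzTowards π K (frontier S)) : KeepsInside f g π S S := by
  obtain ⟨Cf, hCf⟩ := hsys.bounded_f
  obtain ⟨Cg, hCg⟩ := hsys.bounded_g
  obtain ⟨R, hR⟩ := hsys.compact_U.isBounded.exists_norm_le
  have htan : LocallyLipschitzTowards (fun x => f x + g x (π x)) (posTangentConeAt S)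
      (frontier S) :=
    (hπ.add_clm_apply hsys.lipschitz_f hsys.lipschitz_g fun y _ u hu => hR u (hKU y hu)).mono
      subset_rfl fun y hy => image_subset_iff.2 (hK y hy)
  have hcont : ContinuousOn (fun x => f x + g x (π x)) N :=
    hsys.lipschitz_f.continuous.continuousOn.add
      (hsys.lipschitz_g.continuous.continuousOn.clm_apply hπN)
  have hbound : ∀ x ∈ N, ‖f x + g x (π x)‖ ≤ Cf + Cg * R := fun x hx =>
    (norm_add_le _ _).trans
      (add_le_add (hCf x) ((g x).le_of_opNorm_le_of_le (hCg x) (hR _ (hπU hx))))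
  exact fun x₀ hx₀ => ⟨exists_isIntegralCurveOn_Ici_of_continuousOn hS htan hN hSN hcont hbound hx₀,
    fun T x hx hxT t ht => mem_of_isIntegralCurveOn_Icc hS htan hxT (hx ▸ hx₀) ht⟩

theorem KeepsInside.isControlInvariant (hf : Continuous f) (hg : Continuous g)
    (hπ : Continuous π) (hπU : ∀ x, π x ∈ U) (hk : KeepsInside f g π S S) :
    IsControlInvariant f g U S := by
  intro x₀ hx₀
  obtain ⟨⟨x, hx, hxt⟩, hin⟩ := hk x₀ hx₀
  have hxc : ContinuousOn x (Ici 0) := fun t ht => (hxt t ht).continuousWithinAt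
  have hxmax : Continuous fun t => x (max t 0) :=
    hxc.comp_continuous (continuous_id.max continuous_const) fun t => le_max_right t 0
  refine ⟨fun t => π (x (max t 0)), x, (hπ.comp hxmax).measurable, fun t _ => hπU _, hxc,
    fun t ht => ?_, fun t ht => hin t x hx
      (fun s hs => (hxt s hs.1).mono Icc_subset_Ici_self) t (right_mem_Icc.2 ht)⟩
  have hinput : EqOn (fun s => f (x s) + g (x s) (π (x (max s 0))))
      (fun s => f (x s) + g (x s) (π (x s))) (uIcc 0 t) := fun s hs => by
    rw [uIcc_of_le ht] at hs
    simp only [max_eq_left hs.1]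
  have hvel : ContinuousOn (fun s => f (x s) + g (x s) (π (x s))) (uIcc 0 t) := by
    have hxI : ContinuousOn x (uIcc 0 t) :=
      hxc.mono (uIcc_of_le ht ▸ Icc_subset_Ici_self)
    exact (hf.comp_continuousOn hxI).add
      ((hg.comp_continuousOn hxI).clm_apply (hπ.comp_continuousOn hxI))
  have hFTC : ∫ s in (0 : ℝ)..t, (f (x s) + g (x s) (π (x s))) = x t - x 0 :=
    intervalIntegral.integral_eq_sub_of_hasDeriv_right_of_le ht (hxc.mono Icc_subset_Ici_self)
      (fun s hs => (hxt s hs.1.le).mono fun z hz => hs.1.le.trans (le_of_lt hz))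
      hvel.intervalIntegrable
  refine ⟨(hvel.congr hinput).intervalIntegrable, ?_⟩
  rw [intervalIntegral.integral_congr hinput, hFTC, hx, add_sub_cancel]

theorem convex_halfspaceInputs (hU : Convex ℝ U) (x : Vec n) :
    Convex ℝ (halfspaceInputs U a b x) :=
  hU.inter (convex_halfSpace_ge (innerSL ℝ (a x)).toLinearMap.isLinear (b x))

theorem isCompact_halfspaceInputs (hU : IsCompact U) (x : Vec n) :
    IsCompact (halfspaceInputs U a b x) :=
  hU.inter_right (isClosed_le continuous_const (innerSL ℝ (a x)).continuous)

/-- The states at which the half-space constraint satisfies Slater's condition: some admissible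
input fulfils it strictly. -/
def slaterStates (U : Set (Vec m)) (a : Vec n → Vec m) (b : Vec n → ℝ) : Set (Vec n) :=
  {x | ∃ u ∈ U, b x < inner ℝ (a x) u}

theorem isOpen_slaterStates (ha : Continuous a) (hb : Continuous b) :
    IsOpen (slaterStates U a b) := by
  have hunion : slaterStates U a b = ⋃ u ∈ U, {x | b x < inner ℝ (a x) u} := by
    ext x
    simp [slaterStates]
  rw [hunion]
  exact isOpen_biUnion fun u _ => isOpen_lt hb (ha.inner continuous_const)

theorem halfspaceInputs_nonempty_of_mem_slaterStates {x : Vec n} (hx : x ∈ slaterStates U a b) :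
    (halfspaceInputs U a b x).Nonempty := by
  obtain ⟨u, hu, hxu⟩ := hx
  exact ⟨u, hu, hxu.le⟩

theorem mem_slaterStates_of_interior_nonempty {x : Vec n} (hab : ¬(a x = 0 ∧ b x = 0))
    (hint : (interior (halfspaceInputs U a b x)).Nonempty) : x ∈ slaterStates U a b := by
  obtain ⟨u, hu⟩ := hint
  obtain ⟨huU, hxu⟩ := interior_subset hu
  by_cases hax : a x = 0
  · rw [hax, inner_zero_left] at hxu
    refine ⟨u, huU, ?_⟩
    rw [hax, inner_zero_left]
    exact hxu.lt_of_ne fun hbx => hab ⟨hax, hbx⟩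
  · have hlim : Tendsto (fun s : ℝ => u + s • a x) (𝓝[>] 0) (𝓝 u) :=
      ((by fun_prop : Continuous fun s : ℝ => u + s • a x).tendsto' 0 u (by simp)).mono_left
        nhdsWithin_le_nhds
    obtain ⟨s, hs, hs0⟩ := ((hlim.eventually (mem_interior_iff_mem_nhds.1 hu)).and
      eventually_mem_nhdsWithin).exists
    refine ⟨u + s • a x, hs.1, ?_⟩
    rw [inner_add_right, real_inner_smul_right]
    have hgain : 0 < s * inner ℝ (a x) (a x) := mul_pos hs0 (real_inner_self_pos.2 hax)
    linarith

theorem exists_mem_halfspaceInputs_dist_le (hUc : Convex ℝ U) (hUb : Bornology.IsBounded U)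
    (ha : LocallyLipschitz a) (hb : LocallyLipschitz b) {p : Vec n} (hp : p ∈ slaterStates U a b) :
    ∃ V ∈ 𝓝 p, ∃ L : ℝ, ∀ x ∈ V, ∀ y ∈ V, ∀ u ∈ halfspaceInputs U a b x,
      ∃ w ∈ halfspaceInputs U a b y, dist u w ≤ L * dist x y := by
  obtain ⟨v, hv, hpv⟩ := hp
  obtain ⟨R, hR⟩ := hUb.exists_norm_le
  have hR0 : 0 ≤ R := (norm_nonneg v).trans (hR v hv)
  obtain ⟨La, Va, hVa, hLa⟩ := ha p
  obtain ⟨Lb, Vb, hVb, hLb⟩ := hb p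
  obtain ⟨δ, hδ, hδv⟩ : ∃ δ > 0, δ < inner ℝ (a p) v - b p := exists_between (sub_pos.2 hpv)
  have hslack : ∀ᶠ y in 𝓝 p, δ < inner ℝ (a y) v - b y :=
    ((ha.continuous.inner continuous_const).sub hb.continuous).continuousAt.eventually
      (lt_mem_nhds hδv)
  refine ⟨(Va ∩ Vb) ∩ {y | δ < inner ℝ (a y) v - b y}, inter_mem (inter_mem hVa hVb) hslack,
    (La * R + Lb) / δ * (2 * R), ?_⟩
  rintro x ⟨⟨hxa, hxb⟩, -⟩ y ⟨⟨hya, hyb⟩, hyv : δ < inner ℝ (a y) v - b y⟩ u ⟨huU, hxu⟩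
  have hviolation : b y - (La * R + Lb) * dist x y ≤ inner ℝ (a y) u := by
    have hinner : inner ℝ (a x) u - inner ℝ (a y) u ≤ La * dist x y * R := by
      rw [← inner_sub_left]
      refine (real_inner_le_norm _ _).trans
        (mul_le_mul ?_ (hR u huU) (norm_nonneg _) (by positivity))
      simpa only [dist_eq_norm] using hLa.dist_le_mul x hxa y hya
    have hbound : b y - b x ≤ Lb * dist x y := by
      rw [dist_comm]
      exact (le_abs_self _).trans (hLb.dist_le_mul y hyb x hxb)
    linarith
  obtain ⟨w, hwU, hw, huw⟩ := exists_mem_le_map_dist_le hUc huU hv (innerSL ℝ (a y)).toLinearMap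
    (by positivity) hδ hviolation (lt_sub_iff_add_lt'.1 hyv).le
  refine ⟨w, ⟨hwU, hw⟩, huw.trans ?_⟩
  calc (La * R + Lb) * dist x y / δ * dist u v
      ≤ (La * R + Lb) * dist x y / δ * (R + R) := by
        gcongr
        exact dist_le_norm_add_norm u v |>.trans (add_le_add (hR u huU) (hR v hv))
    _ = (La * R + Lb) / δ * (2 * R) * dist x y := by ring

theorem locallyLipschitzTowards_halfspaceInputs (hUc : Convex ℝ U) (hUb : Bornology.IsBounded U)
    (ha : LocallyLipschitz a) (hb : LocallyLipschitz b)
    (hπ : ∀ x ∈ slaterStates U a b, π x ∈ halfspaceInputs U a b x) :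
    LocallyLipschitzTowards π (halfspaceInputs U a b) (slaterStates U a b) := by
  intro p hp
  obtain ⟨V, hV, L, hL⟩ := exists_mem_halfspaceInputs_dist_le hUc hUb ha hb hp
  have hopen := isOpen_slaterStates (U := U) ha.continuous hb.continuous
  exact ⟨V ∩ slaterStates U a b, inter_mem hV (hopen.mem_nhds hp), L,
    fun x hx y hy => hL x hx.1 y hy.1.1 _ (hπ x hx.2)⟩

theorem existsUnique_isMinNormInput (hUc : Convex ℝ U) (hUk : IsCompact U) (r : Vec m) {x : Vec n}
    (hne : (halfspaceInputs U a b x).Nonempty) : ∃! u, IsMinNormInput U a b r x u :=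
  existsUnique_isMinOn_norm_sub_sq (convex_halfspaceInputs hUc x)
    (isCompact_halfspaceInputs hUk x).isComplete hne r

theorem IsMinNormFilter.continuousAt (hUc : Convex ℝ U) (hUb : Bornology.IsBounded U)
    (ha : LocallyLipschitz a) (hb : LocallyLipschitz b) (hsafe : IsMinNormFilter U a b πref πsafe)
    {p : Vec n} (hp : p ∈ slaterStates U a b) (href : ContinuousAt πref p) :
    ContinuousAt πsafe p := by
  obtain ⟨R, hR⟩ := hUb.exists_norm_le
  obtain ⟨V, hV, L, hL⟩ := exists_mem_halfspaceInputs_dist_le hUc hUb ha hb hp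
  obtain ⟨hpmem, hpmin⟩ := hsafe p (halfspaceInputs_nonempty_of_mem_slaterStates hp)
  let q : Vec n → ℝ := fun x => ‖πref p - πsafe p‖ * (L * dist x p) +
    (‖πref x‖ + R) * (L * dist x p) + ‖πref x - πref p‖ * (R + R)
  have hq : Tendsto (fun x => √(q x)) (𝓝 p) (𝓝 0) := by
    have hcont : ContinuousAt (fun x => √(q x)) p := by fun_prop
    simpa [ContinuousAt, q] using hcont
  refine tendsto_iff_norm_sub_tendsto_zero.2
    (squeeze_zero' (.of_forall fun _ => norm_nonneg _) ?_ hq)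
  filter_upwards [hV] with x hx
  obtain ⟨w', hw', hpw'⟩ := hL p (mem_of_mem_nhds hV) x hx _ hpmem
  obtain ⟨hxmem, hxmin⟩ := hsafe x ⟨w', hw'⟩
  obtain ⟨w, hw, hxw⟩ := hL x hx p (mem_of_mem_nhds hV) _ hxmem
  rw [dist_eq_norm] at hxw
  rw [dist_eq_norm, dist_comm p x] at hpw'
  refine Real.le_sqrt_of_sq_le ((norm_sub_sq_le_of_isMinOn (convex_halfspaceInputs hUc p)
    (convex_halfspaceInputs hUc x) hpmem hpmin hxmem hxmin hw hw').trans ?_)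
  have hdiam : ‖πsafe x - πsafe p‖ ≤ R + R := norm_sub_le_of_le (hR _ hxmem.1) (hR _ hpmem.1)
  have hres : ‖πref x - πsafe x‖ ≤ ‖πref x‖ + R := norm_sub_le_of_le le_rfl (hR _ hxmem.1)
  have hres0 : 0 ≤ ‖πref x‖ + R := (norm_nonneg _).trans hres
  refine add_le_add (add_le_add ?_ ?_) ?_
  · exact mul_le_mul_of_nonneg_left hxw (norm_nonneg _)
  · exact mul_le_mul hres hpw' (norm_nonneg _) hres0
  · exact mul_le_mul_of_nonneg_left hdiam (norm_nonneg _)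

theorem exists_contDiff_feedback (hUc : Convex ℝ U) (hU : U.Nonempty) (ha : Continuous a)
    (hb : Continuous b) (hS : IsClosed S) (hslater : S ⊆ slaterStates U a b) :
    ∃ π : Vec n → Vec m, ContDiff ℝ 1 π ∧ (∀ x, π x ∈ U) ∧
      ∀ x ∈ S, b x ≤ inner ℝ (a x) (π x) := by
  have hconv : ∀ x, Convex ℝ {u | u ∈ U ∧ (x ∈ S → b x ≤ inner ℝ (a x) u)} := fun x => by
    by_cases hx : x ∈ S
    · simpa only [hx, true_imp_iff] using! convex_halfspaceInputs (a := a) (b := b) hUc x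
    · simpa only [hx, false_imp_iff, and_true] using! hUc
  have hlocal : ∀ x, ∃ u, ∀ᶠ y in 𝓝 x, u ∈ {u | u ∈ U ∧ (y ∈ S → b y ≤ inner ℝ (a y) u)} :=
    fun x => by
    by_cases hx : x ∈ S
    · obtain ⟨u, hu, hxu⟩ := hslater hx
      refine ⟨u, ?_⟩
      filter_upwards [hb.continuousAt.eventually_lt
        (ha.inner continuous_const).continuousAt hxu] with y hy
      exact ⟨hu, fun _ => hy.le⟩
    · obtain ⟨u, hu⟩ := hU
      refine ⟨u, ?_⟩
      filter_upwards [hS.isOpen_compl.mem_nhds hx] with y hy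
      exact ⟨hu, fun hyS => absurd hyS hy⟩
  obtain ⟨π, hπ⟩ :=
    exists_contMDiffMap_forall_mem_convex_of_local_const (n := 1) 𝓘(ℝ, Vec n) hconv hlocal
  exact ⟨π, π.contMDiff.contDiff, fun x => (hπ x).1, fun x => (hπ x).2⟩

theorem exists_locallyLipschitz_feedback (hUc : Convex ℝ U) (hU : U.Nonempty) (ha : Continuous a)
    (hb : Continuous b) (hS : IsClosed S) (hslater : S ⊆ slaterStates U a b) :
    ∃ π : Vec n → Vec m, LocallyLipschitz π ∧ (IsCompact S → ∃ L, LipschitzWith L π) ∧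
      (∀ x, π x ∈ U) ∧ ∀ x ∈ S, b x ≤ inner ℝ (a x) (π x) := by
  obtain ⟨π, hπ, hπU, hπS⟩ := exists_contDiff_feedback hUc hU ha hb hS hslater
  by_cases hSk : IsCompact S
  · obtain ⟨ψ, ⟨L, hL⟩, hψU, hψ⟩ := exists_lipschitzWith_forall_mem_eqOn hUc hπ hπU hSk.isBounded
    exact ⟨ψ, hL.locallyLipschitz, fun _ => ⟨L, hL⟩, hψU, fun x hx => hψ hx ▸ hπS x hx⟩
  · exact ⟨π, hπ.locallyLipschitz, fun hk => absurd hk hSk, hπU, hπS⟩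

theorem keepsInside_of_locallyLipschitz (hsys : IsAdmissibleSystem f g U) (hS : IsClosed S)
    (htan : ∀ x ∈ frontier S, ∀ u ∈ halfspaceInputs U a b x, f x + g x u ∈ posTangentConeAt S x)
    (hπ : LocallyLipschitz π) (hπU : ∀ x, π x ∈ U) (hπS : ∀ x ∈ S, b x ≤ inner ℝ (a x) (π x)) :
    KeepsInside f g π S S :=
  keepsInside_of_locallyLipschitzTowards hsys hS (fun _ => inter_subset_left) htan isOpen_univ
    (subset_univ S) hπ.continuous.continuousOn (fun x _ => hπU x)
    (locallyLipschitzTowards_of_locallyLipschitz hπ fun x hx =>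
      ⟨hπU x, hπS x (hS.frontier_subset hx)⟩)

theorem IsMinNormFilter.keepsInside (hsys : IsAdmissibleSystem f g U) (hUc : Convex ℝ U)
    (hS : IsClosed S) (ha : LocallyLipschitz a) (hb : LocallyLipschitz b)
    (hslater : S ⊆ slaterStates U a b)
    (htan : ∀ x ∈ frontier S, ∀ u ∈ halfspaceInputs U a b x, f x + g x u ∈ posTangentConeAt S x)
    (href : Continuous πref) (hsafe : IsMinNormFilter U a b πref πsafe) :
    KeepsInside f g πsafe S S := by
  have hUb := hsys.compact_U.isBounded
  have hmem : ∀ x ∈ slaterStates U a b, πsafe x ∈ halfspaceInputs U a b x := fun x hx =>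
    (hsafe x (halfspaceInputs_nonempty_of_mem_slaterStates hx)).1
  exact keepsInside_of_locallyLipschitzTowards hsys hS (fun _ => inter_subset_left) htan
    (isOpen_slaterStates ha.continuous hb.continuous) hslater
    (fun x hx => (hsafe.continuousAt hUc hUb ha hb hx href.continuousAt).continuousWithinAt)
    (fun x hx => (hmem x hx).1)
    ((locallyLipschitzTowards_halfspaceInputs hUc hUb ha hb hmem).mono
      (hS.frontier_subset.trans hslater) fun _ _ => subset_rfl)

end ControlSystem

end SafetyFilter

open SafetyFilter in
theorem theorem1_general {n m : ℕ} {f : Vec n → Vec n} {g : Vec n → (Vec m →L[ℝ] Vec n)}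
    {U : Set (Vec m)} {S : Set (Vec n)} {a : Vec n → Vec m} {b : Vec n → ℝ}
    (hsys : IsAdmissibleSystem f g U) (hUc : Convex ℝ U) (hUne : U.Nonempty) (hS : IsClosed S)
    (ha : LocallyLipschitz a) (hb : LocallyLipschitz b) (hslater : S ⊆ slaterStates U a b)
    (htan : ∀ x ∈ frontier S, ∀ u ∈ halfspaceInputs U a b x,
      f x + g x u ∈ posTangentConeAt S x) :
    IsDiscriminatingHyperplane f g U S a b ∧
    (∀ π : Vec n → Vec m, LocallyLipschitz π → (∀ x, π x ∈ U) →
      (∀ x ∈ S, b x ≤ inner ℝ (a x) (π x)) → KeepsInside f g π S S) ∧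
    (∀ πref : Vec n → Vec m, Continuous πref →
      (∀ x ∈ S, ∃! u, IsMinNormInput U a b (πref x) x u) ∧
      ∀ πsafe : Vec n → Vec m, IsMinNormFilter U a b πref πsafe →
        KeepsInside f g πsafe S S) := by
  have hkeep : ∀ π : Vec n → Vec m, LocallyLipschitz π → (∀ x, π x ∈ U) →
      (∀ x ∈ S, b x ≤ inner ℝ (a x) (π x)) → KeepsInside f g π S S := fun π =>
    keepsInside_of_locallyLipschitz hsys hS htan
  obtain ⟨π, hπ, hπL, hπU, hπS⟩ :=
    exists_locallyLipschitz_feedback hUc hUne ha.continuous hb.continuous hS hslater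
  have hinv : IsControlInvariant f g U S := (hkeep π hπ hπU hπS).isControlInvariant
    hsys.lipschitz_f.continuous hsys.lipschitz_g.continuous hπ.continuous hπU
  refine ⟨⟨hinv, fun X hX => ⟨hX, π, hπ, hπL, hπU, fun x hx => sub_nonneg.2 (hπS x hx),
    (hkeep π hπ hπU hπS).mono hX⟩⟩, hkeep, fun πref href => ⟨fun x hx => ?_, fun πsafe hsafe => ?_⟩⟩
  · exact existsUnique_isMinNormInput hUc hsys.compact_U (πref x)
      (halfspaceInputs_nonempty_of_mem_slaterStates (hslater hx))
  · exact hsafe.keepsInside hsys hUc hS ha hb hslater htan href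

theorem theorem1 {n m : ℕ}
    (f : SafetyFilter.Vec n → SafetyFilter.Vec n)
    (g : SafetyFilter.Vec n → (SafetyFilter.Vec m →L[ℝ] SafetyFilter.Vec n))
    (U : Set (SafetyFilter.Vec m)) (S : Set (SafetyFilter.Vec n))
    (h : SafetyFilter.Vec n → ℝ)
    (a : SafetyFilter.Vec n → SafetyFilter.Vec m) (b : SafetyFilter.Vec n → ℝ)
    (hsys : SafetyFilter.IsAdmissibleSystem f g U)
    (hU : SafetyFilter.IsPolytope U)
    (hh : SafetyFilter.IsDistanceLike h S)
    (ha : LocallyLipschitz a) (hb : LocallyLipschitz b)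
    (hab : ∀ x ∈ S, ¬ (a x = 0 ∧ b x = 0))
    (hint : ∀ x ∈ S, (interior (SafetyFilter.halfspaceInputs U a b x)).Nonempty)
    (hsub : ∀ x ∈ frontier S,
      SafetyFilter.halfspaceInputs U a b x ⊆ SafetyFilter.nagumoInputs f g U h x) :
    SafetyFilter.IsDiscriminatingHyperplane f g U S a b ∧
    (∀ π : SafetyFilter.Vec n → SafetyFilter.Vec m, LocallyLipschitz π → (∀ x, π x ∈ U) →
      (∀ x ∈ S, b x ≤ inner ℝ (a x) (π x)) → SafetyFilter.KeepsInside f g π S S) ∧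
    (∀ πref : SafetyFilter.Vec n → SafetyFilter.Vec m,
      LocallyLipschitz πref → (∀ x, πref x ∈ U) →
      (∀ x ∈ S, ∃! u, SafetyFilter.IsMinNormInput U a b (πref x) x u) ∧
      ∀ πsafe : SafetyFilter.Vec n → SafetyFilter.Vec m,
        SafetyFilter.IsMinNormFilter U a b πref πsafe →
        SafetyFilter.KeepsInside f g πsafe S S) := by
  obtain ⟨hdisc, hkeep, hfilter⟩ := theorem1_general hsys hU.convex hU.nonempty hh.isClosed ha hb
    (fun x hx => SafetyFilter.mem_slaterStates_of_interior_nonempty (hab x hx) (hint x hx))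
    fun x hx u hu => hh.mem_posTangentConeAt hx (hsub x hx hu).2
  exact ⟨hdisc, hkeep, fun πref href _ => hfilter πref href.continuous⟩
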